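/- A multi-matrix algebra is a finite direct sum $\mathcal{A}=\bigoplus_{x\in X}\mathbb{M}_{m_x}$ of complex matrix algebras, with componentwise operations, adjoint $\dagger$ the blockwise conjugate transpose, and trace the sum of the traces of the blocks. A state $\rho\in\mathcal{A}$ is an element all of whose blocks are positive semidefinite and which has trace $1$. For self-adjoint $A$ in a multi-matrix algebra put $$S(A)=-\sum_{\lambda}\lambda\log|\lambda|,$$ where $\lambda$ runs over the eigenvalues, with multiplicity, of the block-diagonal matrix of $A$, and $0\log 0=0$. For a linear map $\mathcal{E}:\mathcal{A}\to\mathcal{B}$ between multi-matrix algebras, the channel state is $\mathscr{J}[\mathcal{E}]=(\mathrm{id}_{\mathcal{A}}\otimes\mathcal{E})(\mu_{\mathcal{A}}^*(1_{\mathcal{A}}))\in\mathcal{A}\otimes\mathcal{B}$, where $\mu_{\mathcal{A}}:\mathcal{A}\otimes\mathcal{A}\to\mathcal{A}$ is the multiplication map $a\otimes b\mapsto ab$ and ${}^*$ denotes the adjoint with respect to the Hilbert–Schmidt inner products $\langle a,b\rangle=\mathrm{tr}(a^\dagger b)$. For $p\in[0,1]$ the symmetric $p$-bloom of $(\rho,\mathcal{E})$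 is $$\psi_p(\rho,\mathcal{E})=\tfrac12\Big((\rho^p\otimes 1)\,\mathscr{J}[\mathcal{E}]\,(\rho^{1-p}\otimes 1)+(\rho^{1-p}\otimes 1)\,\mathscr{J}[\mathcal{E}]\,(\rho^{p}\otimes 1)\Big),\qquad \rho^0:=1,$$ and one sets $$S_p(\rho,\mathcal{E})=S(\psi_p(\rho,\mathcal{E})),\qquad H_p(\rho,\mathcal{E})=S_p(\rho,\mathcal{E})-S(\rho),$$ $$I_p(\rho,\mathcal{E})=S(\rho)+S(\mathcal{E}(\rho))-S_p(\rho,\mathcal{E}),\qquad K_p(\rho,\mathcal{E})=S_p(\rho,\mathcal{E})-S(\mathcal{E}(\rho)).$$ **Theorem.** Let $\mathcal{A},\mathcal{B}$ be multi-matrix algebras, let $\mathcal{E}:\mathcal{A}\to\mathcal{B}$ be a $*$-isomorphism and let $\rho\in\mathcal{A}$ be a state. Then, for all $p\in[0,1]$: i. $S_p(\rho,\mathcal{E})=I_p(\rho,\mathcal{E})=S(\rho)$; ii. $H_p(\rho,\mathcal{E})=K_p(\rho,\mathcal{E})=0$. -/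

import Mathlib

open scoped Kronecker

namespace QuantumProcess

set_option linter.unusedSectionVars false

section MultiMatrix

open scoped ComplexOrder

variable {X Y : Type*} {ι : X → Type*} {κ : Y → Type*}

/-- The multi-matrix algebra `⨁ₓ M_{ι x}`, with entries in `ℂ`. All operations (product, unit,
adjoint `star`, linear structure) are componentwise; `star` on a block is the conjugate transpose.
The case `ι x = Fin (m x)` is the algebra `⨁ₓ M_{m x}`. -/
abbrev MMat {X : Type*} (ι : X → Type*) : Type _ := ∀ x, Matrix (ι x) (ι x) ℂ

/-- The block sizes of a tensor product of multi-matrix algebras: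
`(⨁ₓ M_{ι x}) ⊗ (⨁_y M_{κ y}) = ⨁_{(x,y)} M_{ι x × κ y}`. -/
abbrev TIdx (ι : X → Type*) (κ : Y → Type*) : X × Y → Type _ := fun z => ι z.1 × κ z.2

/-- The pure tensor `a ⊗ b`. -/
def tmul (a : MMat ι) (b : MMat κ) : MMat (TIdx ι κ) := fun z => a z.1 ⊗ₖ b z.2

variable [Fintype X] [DecidableEq X] [∀ x, Fintype (ι x)] [∀ x, DecidableEq (ι x)]
variable [Fintype Y] [DecidableEq Y] [∀ y, Fintype (κ y)] [∀ y, DecidableEq (κ y)]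

/-- The trace on a multi-matrix algebra. -/
def tr (a : MMat ι) : ℂ := ∑ x, (a x).trace

/-- The matrix unit `E_{ij}` in the block `x`. -/
def unit (x : X) (i j : ι x) : MMat ι :=
  Pi.single (M := fun x => Matrix (ι x) (ι x) ℂ) x (Matrix.single i j 1)

/-- A state: every block is positive semidefinite, and the trace is one. -/
structure IsState (ρ : MMat ι) : Prop where
  posSemidef : ∀ x, (ρ x).PosSemidef
  tr_eq_one : tr ρ = 1

/-- The Hilbert–Schmidt adjoint of a linear map between multi-matrix algebras: the linear map
with `tr (F(a)† b) = tr (a† F*(b))`, see `tr_hsAdjoint` and `eq_hsAdjoint`. -/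
def hsAdjoint (F : MMat ι →ₗ[ℂ] MMat κ) : MMat κ →ₗ[ℂ] MMat ι where
  toFun b := fun x => Matrix.of fun i j => tr (star (F (unit x i j)) * b)
  map_add' b c := by
    ext x i j
    simp [tr, mul_add, Finset.sum_add_distrib]
  map_smul' r b := by
    ext x i j
    simp [tr, Finset.mul_sum]

/-- The multiplication map `μ : 𝒜 ⊗ 𝒜 → 𝒜`, with `μ (a ⊗ b) = a b`, see `mulMap_tmul`. -/
def mulMap (ι : X → Type*) [∀ x, Fintype (ι x)] : MMat (TIdx ι ι) →ₗ[ℂ] MMat ι where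
  toFun t := fun x => Matrix.of fun i j => ∑ k, t (x, x) (i, k) (k, j)
  map_add' s t := by
    ext x i j
    simp [Finset.sum_add_distrib]
  map_smul' r t := by
    ext x i j
    simp [Finset.mul_sum]

/-- The map `id ⊗ F : 𝒞 ⊗ 𝒜 → 𝒞 ⊗ ℬ`, with `(id ⊗ F) (c ⊗ a) = c ⊗ F a`, see `idTensor_tmul`. -/
def idTensor {Z : Type*} (υ : Z → Type*) (F : MMat ι →ₗ[ℂ] MMat κ) :
    MMat (TIdx υ ι) →ₗ[ℂ] MMat (TIdx υ κ) where
  toFun t := fun z => Matrix.of fun u v =>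
    F (fun x => Matrix.of fun i j => t (z.1, x) (u.1, i) (v.1, j)) z.2 u.2 v.2
  map_add' s t := by
    ext z u v
    exact congrFun (congrFun (congrFun (F.map_add
      (fun x => Matrix.of fun i j => s (z.1, x) (u.1, i) (v.1, j))
      (fun x => Matrix.of fun i j => t (z.1, x) (u.1, i) (v.1, j))) z.2) u.2) v.2
  map_smul' r t := by
    ext z u v
    exact congrFun (congrFun (congrFun (F.map_smul r
      (fun x => Matrix.of fun i j => t (z.1, x) (u.1, i) (v.1, j))) z.2) u.2) v.2

/-- The channel state `𝒥[ℰ] = (id ⊗ ℰ)(μ*(1))`. -/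
def channelState (E : MMat ι →ₗ[ℂ] MMat κ) : MMat (TIdx ι κ) :=
  idTensor ι E (hsAdjoint (mulMap ι) 1)

/-- The power `ρ ^ p`, block by block, through the spectral decomposition of the hermitian matrix
`ρ x`. Since `t ^ 0 = 1` for every real `t`, this gives `ρ ^ 0 = 1`. -/
noncomputable def matPow (ρ : MMat ι) (p : ℝ) : MMat ι := fun x => cfc (fun t : ℝ => t ^ p) (ρ x)

/-- The `p`-bloom `(ρ^p ⊗ 1) 𝒥[ℰ] (ρ^(1-p) ⊗ 1)`. -/
noncomputable def bloom (p : ℝ) (ρ : MMat ι) (E : MMat ι →ₗ[ℂ] MMat κ) : MMat (TIdx ι κ) :=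
  tmul (matPow ρ p) 1 * channelState E * tmul (matPow ρ (1 - p)) 1

/-- The symmetric `p`-bloom. -/
noncomputable def symBloom (p : ℝ) (ρ : MMat ι) (E : MMat ι →ₗ[ℂ] MMat κ) : MMat (TIdx ι κ) :=
  (1 / 2 : ℂ) • (bloom p ρ E + bloom (1 - p) ρ E)

end MultiMatrix

section Entropy

/-- The multi-spectrum: eigenvalues with algebraic multiplicities. -/
noncomputable def mspec {n : Type*} [Fintype n] [DecidableEq n] (A : Matrix n n ℂ) : Multiset ℂ :=
  A.charpoly.roots

/-- The entropy `-∑ λ log |λ|` of a self-adjoint matrix, the sum being over the multi-spectrum,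
which is real for such a matrix (see `matEntropy_eq`). -/
noncomputable def matEntropy {n : Type*} [Fintype n] [DecidableEq n] (A : Matrix n n ℂ) : ℝ :=
  -((mspec A).map fun z => z.re * Real.log |z.re|).sum

variable {X Y : Type*} {ι : X → Type*} {κ : Y → Type*}
variable [Fintype X] [DecidableEq X] [∀ x, Fintype (ι x)] [∀ x, DecidableEq (ι x)]
variable [Fintype Y] [DecidableEq Y] [∀ y, Fintype (κ y)] [∀ y, DecidableEq (κ y)]

/-- The entropy of a self-adjoint element of a multi-matrix algebra: that of its block-diagonal
representation. On states this is the von Neumann entropy. -/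
noncomputable def entropy (a : MMat ι) : ℝ := matEntropy (Matrix.blockDiagonal' a)

/-- The `ψ`-entropy of `(ρ, ℰ)`. Here `ψ` is the component at `(𝒜, ℬ)` of a hermitian state over
time function. -/
noncomputable def psiEntropy (ψ : MMat ι → (MMat ι →ₗ[ℂ] MMat κ) → MMat (TIdx ι κ))
    (ρ : MMat ι) (E : MMat ι →ₗ[ℂ] MMat κ) : ℝ :=
  entropy (ψ ρ E)

/-- The `ψ`-conditional entropy. -/
noncomputable def psiCondEntropy (ψ : MMat ι → (MMat ι →ₗ[ℂ] MMat κ) → MMat (TIdx ι κ))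
    (ρ : MMat ι) (E : MMat ι →ₗ[ℂ] MMat κ) : ℝ :=
  psiEntropy ψ ρ E - entropy ρ

/-- The `ψ`-mutual information. -/
noncomputable def psiMutualInfo (ψ : MMat ι → (MMat ι →ₗ[ℂ] MMat κ) → MMat (TIdx ι κ))
    (ρ : MMat ι) (E : MMat ι →ₗ[ℂ] MMat κ) : ℝ :=
  entropy ρ + entropy (E ρ) - psiEntropy ψ ρ E

/-- The `ψ`-information discrepancy. -/
noncomputable def psiInfoDisc (ψ : MMat ι → (MMat ι →ₗ[ℂ] MMat κ) → MMat (TIdx ι κ))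
    (ρ : MMat ι) (E : MMat ι →ₗ[ℂ] MMat κ) : ℝ :=
  psiEntropy ψ ρ E - entropy (E ρ)

end Entropy

section Checks

variable {X Y : Type*} {ι : X → Type*} {κ : Y → Type*}

theorem mulMap_tmul [∀ x, Fintype (ι x)] (a b : MMat ι) : mulMap ι (tmul a b) = a * b := by
  ext x i j
  simp [mulMap, tmul, Matrix.mul_apply]

theorem idTensor_tmul {Z : Type*} {υ : Z → Type*} (F : MMat ι →ₗ[ℂ] MMat κ)
    (c : MMat υ) (a : MMat ι) : idTensor υ F (tmul c a) = tmul c (F a) := by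
  ext z u v
  have h : (fun x => Matrix.of fun i j => c z.1 u.1 v.1 * a x i j : MMat ι)
      = c z.1 u.1 v.1 • a := by
    ext x i j
    simp
  simp only [idTensor, tmul, LinearMap.coe_mk, AddHom.coe_mk, Matrix.of_apply,
    Matrix.kroneckerMap_apply]
  rw [h, map_smul]
  rfl

variable [Fintype X] [DecidableEq X] [∀ x, Fintype (ι x)] [∀ x, DecidableEq (ι x)]
variable [Fintype Y] [DecidableEq Y] [∀ y, Fintype (κ y)] [∀ y, DecidableEq (κ y)]

theorem eq_sum_unit (a : MMat ι) : a = ∑ x, ∑ i, ∑ j, a x i j • unit x i j := by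
  ext y k l
  simp only [Finset.sum_apply, Matrix.sum_apply, Pi.smul_apply, Matrix.smul_apply, unit]
  rw [Finset.sum_eq_single y]
  · simp [Matrix.single_apply, ite_and]
  · intro x _ hx
    simp [Pi.single_eq_of_ne (Ne.symm hx)]
  · simp

theorem star_unit (x : X) (i j : ι x) : star (unit x i j : MMat ι) = unit x j i := by
  ext y k l
  by_cases hy : y = x
  · subst hy
    simp only [unit, Pi.star_apply, Pi.single_eq_same, Matrix.star_eq_conjTranspose,
      Matrix.conjTranspose_single, star_one]
  · simp [unit, Pi.single_eq_of_ne hy]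

theorem tr_star_unit_mul (x : X) (i j : ι x) (b : MMat ι) :
    tr (star (unit x i j) * b) = b x i j := by
  rw [tr, Finset.sum_eq_single x]
  · simp [unit, Matrix.star_eq_conjTranspose, Matrix.trace, Matrix.mul_apply, Matrix.single_apply,
      ite_and]
  · intro y _ hy
    simp [unit, Pi.single_eq_of_ne hy]
  · simp

theorem tr_hsAdjoint (F : MMat ι →ₗ[ℂ] MMat κ) (a : MMat ι) (b : MMat κ) :
    tr (star (F a) * b) = tr (star a * hsAdjoint F b) := by
  have h1 : tr (star (F a) * b) = ∑ x, ∑ i, ∑ j, star (a x i j) * hsAdjoint F b x i j := by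
    conv_lhs => rw [eq_sum_unit a]
    simp only [map_sum, map_smul, star_sum, star_smul, Finset.sum_mul, hsAdjoint, tr,
      LinearMap.coe_mk, AddHom.coe_mk, Matrix.of_apply, Finset.sum_apply, Matrix.trace_sum,
      Pi.mul_apply, Pi.smul_apply, Matrix.trace_smul, smul_mul_assoc, Pi.star_apply, smul_eq_mul]
    rw [Finset.sum_comm]
    refine Finset.sum_congr rfl fun x _ => ?_
    rw [Finset.sum_comm]
    refine Finset.sum_congr rfl fun i _ => ?_
    rw [Finset.sum_comm]
    refine Finset.sum_congr rfl fun j _ => ?_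
    rw [Finset.mul_sum]
  rw [h1, tr]
  refine Finset.sum_congr rfl fun x _ => ?_
  simp only [Matrix.trace, Matrix.diag_apply, Pi.mul_apply, Matrix.mul_apply, Pi.star_apply,
    Matrix.star_apply]
  rw [Finset.sum_comm]

theorem eq_hsAdjoint (F : MMat ι →ₗ[ℂ] MMat κ) (G : MMat κ →ₗ[ℂ] MMat ι)
    (h : ∀ a b, tr (star (F a) * b) = tr (star a * G b)) : G = hsAdjoint F := by
  refine LinearMap.ext fun b => ?_
  ext x i j
  rw [← tr_star_unit_mul x i j (G b), ← h, tr_hsAdjoint, tr_star_unit_mul]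

theorem hsAdjoint_mulMap_one (z : X × X) (u v : ι z.1 × ι z.2) :
    hsAdjoint (mulMap ι) 1 z u v = unit z.1 v.1 u.1 z.2 u.2 v.2 := by
  obtain ⟨x, x'⟩ := z
  obtain ⟨i, i'⟩ := u
  obtain ⟨j, j'⟩ := v
  have h : (unit (x, x') (i, i') (j, j') : MMat (TIdx ι ι)) = tmul (unit x i j) (unit x' i' j') := by
    ext ⟨y, y'⟩ ⟨k, k'⟩ ⟨l, l'⟩
    by_cases hy : x = y
    · by_cases hy' : x' = y'
      · subst hy hy'
        simp only [unit, tmul, Pi.single_eq_same, Matrix.kroneckerMap_apply, Matrix.single_apply,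
          Prod.mk.injEq]
        split_ifs <;> simp_all
      · have : (y, y') ≠ (x, x') := fun e => hy' (Prod.mk.inj e).2.symm
        simp [unit, tmul, Pi.single_eq_of_ne this, Pi.single_eq_of_ne (Ne.symm hy')]
    · have : (y, y') ≠ (x, x') := fun e => hy (Prod.mk.inj e).1.symm
      simp [unit, tmul, Pi.single_eq_of_ne this, Pi.single_eq_of_ne (Ne.symm hy)]
  have h2 : hsAdjoint (mulMap ι) 1 (x, x') (i, i') (j, j')
      = tr (star (unit x i j * unit x' i' j' : MMat ι)) := by
    simp only [hsAdjoint, LinearMap.coe_mk, AddHom.coe_mk, Matrix.of_apply, mul_one]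
    rw [h, mulMap_tmul]
  have h4 : ∀ a b : MMat ι, tr (a * b) = tr (b * a) := fun a b =>
    Finset.sum_congr rfl fun y _ => Matrix.trace_mul_comm _ _
  rw [h2, star_mul, h4, tr_star_unit_mul, star_unit]
  by_cases hx : x' = x
  · subst hx
    simp only [unit, Pi.single_eq_same, Matrix.single_apply]
    congr 1
    exact propext ⟨fun e => ⟨e.2.symm, e.1.symm⟩, fun e => ⟨e.2.symm, e.1.symm⟩⟩
  · simp [unit, Pi.single_eq_of_ne hx, Pi.single_eq_of_ne (Ne.symm hx)]

theorem channelState_apply (E : MMat ι →ₗ[ℂ] MMat κ) (z : X × Y) (u v : ι z.1 × κ z.2) :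
    channelState E z u v = E (unit z.1 v.1 u.1) z.2 u.2 v.2 := by
  simp only [channelState, idTensor, LinearMap.coe_mk, AddHom.coe_mk, Matrix.of_apply]
  have h : (fun x => Matrix.of fun i j => hsAdjoint (mulMap ι) 1 (z.1, x) (u.1, i) (v.1, j))
      = (unit z.1 v.1 u.1 : MMat ι) := by
    ext x i j
    exact hsAdjoint_mulMap_one (z.1, x) (u.1, i) (v.1, j)
  rw [h]

theorem matPow_zero {ρ : MMat ι} (hρ : IsState ρ) : matPow ρ 0 = 1 := by
  funext x
  have h : IsSelfAdjoint (ρ x) := (hρ.posSemidef x).1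
  simp only [matPow, Real.rpow_zero]
  exact cfc_const_one ℝ (ρ x)

theorem matPow_one {ρ : MMat ι} (hρ : IsState ρ) : matPow ρ 1 = ρ := by
  funext x
  have h : IsSelfAdjoint (ρ x) := (hρ.posSemidef x).1
  simp only [matPow, Real.rpow_one]
  exact cfc_id' ℝ (ρ x)

theorem matEntropy_eq {n : Type*} [Fintype n] [DecidableEq n] {A : Matrix n n ℂ}
    (hA : A.IsHermitian) :
    matEntropy A = -∑ i, hA.eigenvalues i * Real.log |hA.eigenvalues i| := by
  simp [matEntropy, mspec, hA.roots_charpoly_eq_eigenvalues, Multiset.map_map]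

theorem isSelfAdjoint_symBloom (p : ℝ) {ρ : MMat ι}
    {E : MMat ι →ₗ[ℂ] MMat κ} (hE : ∀ a, E (star a) = star (E a)) :
    IsSelfAdjoint (symBloom p ρ E) := by
  have h1 : star (channelState E) = channelState E := by
    ext z u v
    rw [Pi.star_apply, Matrix.star_apply, channelState_apply, channelState_apply]
    rw [← star_unit, hE]
    exact star_star _
  have h2 : ∀ q : ℝ, star (tmul (matPow ρ q) (1 : MMat κ)) = tmul (matPow ρ q) 1 := by
    intro q
    have : ∀ x, (matPow ρ q x).conjTranspose = matPow ρ q x := fun x =>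
      (cfc_predicate (fun t : ℝ => t ^ q) (ρ x) : IsSelfAdjoint _)
    funext z
    simp [tmul, Matrix.star_eq_conjTranspose, Matrix.conjTranspose_kronecker, this]
  have h4 : ∀ q : ℝ, star (bloom q ρ E) = bloom (1 - q) ρ E := by
    intro q
    rw [bloom, bloom, star_mul, star_mul, h1, h2, h2, mul_assoc, sub_sub_cancel]
  rw [isSelfAdjoint_iff, symBloom, star_smul, star_add, h4, h4, sub_sub_cancel, add_comm]
  simp

end Checks

end QuantumProcess

/-! Write `J` for the channel state. When `E` is an algebra isomorphism, `J` behaves like a partial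
swap: `(a ⊗ E b) J = J (b ⊗ E a)` (`tmul_mul_channelState`), `J³ = J` (`channelState_pow_three`) and
`tr ((a ⊗ E b) J) = tr (a b)` (`tr_tmul_mul_channelState`). Hence the symmetric bloom is `½ c J`,
where `c = ρ^p ⊗ E(ρ^(1-p)) + ρ^(1-p) ⊗ E(ρ^p)` commutes with `J`. Its odd powers are `2⁻ⁿ cⁿ J`,
and expanding `cⁿ` binomially gives them the trace `tr ρⁿ`. Odd power traces suffice: on a finite
spectrum `t log |t|` agrees with an odd polynomial. The matrices compared may differ in size, since
zero eigenvalues contribute nothing. -/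

namespace QuantumProcess

set_option linter.unusedSectionVars false

/-! ### Trace invariance under algebra isomorphisms. -/

section Trace

variable {X Y : Type*} {ι : X → Type*} {κ : Y → Type*}
variable [Fintype X] [DecidableEq X] [∀ x, Fintype (ι x)] [∀ x, DecidableEq (ι x)]
variable [Fintype Y] [DecidableEq Y] [∀ y, Fintype (κ y)] [∀ y, DecidableEq (κ y)]

theorem tr_mul_comm (a b : MMat ι) : tr (a * b) = tr (b * a) :=
  Finset.sum_congr rfl fun _ _ => Matrix.trace_mul_comm _ _

theorem tr_smul (r : ℂ) (a : MMat ι) : tr (r • a) = r * tr a := by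
  simp [tr, Finset.mul_sum]

theorem tr_sum {S : Type*} (s : Finset S) (f : S → MMat ι) :
    tr (∑ i ∈ s, f i) = ∑ i ∈ s, tr (f i) := by
  simp only [tr, Finset.sum_apply, Matrix.trace_sum]
  exact Finset.sum_comm

theorem unit_mul_unit (x : X) (i j k : ι x) :
    (unit x i j * unit x j k : MMat ι) = unit x i k := by
  simp [unit, ← Pi.single_mul]

theorem unit_mul_unit_of_ne (x : X) (i : ι x) {j k : ι x} (l : ι x) (h : j ≠ k) :
    (unit x i j * unit x k l : MMat ι) = 0 := by
  simp [unit, ← Pi.single_mul, h]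

theorem unit_mul_mul_unit (x : X) (i j k l : ι x) (a : MMat ι) :
    unit x i j * a * unit x k l = a x j k • unit x i l := by
  ext y r s
  by_cases h : y = x
  · subst h
    simp [unit, Matrix.single_apply]
  · simp [unit, Pi.single_eq_of_ne h]

theorem mul_unit_mul_apply (y : Y) (k l : κ y) (f g : MMat κ) (i j : κ y) :
    (f * unit y k l * g) y i j = f y i k * g y l j := by
  simp [unit, Matrix.mul_apply, Matrix.single_apply, ite_and]

/-- Compress the matrix unit `e_lk` at a nonzero entry `f_kl`. The `(k, l)` entry of `f e_lk f = c
f` forces `c = f_kl`, while cyclicity and `f² = f` give the left side trace `f_kl`. -/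
theorem tr_eq_one_of_minimal {f : MMat κ} (hf : f * f = f) (hf0 : f ≠ 0)
    (hmin : ∀ b, ∃ c : ℂ, f * b * f = c • f) : tr f = 1 := by
  obtain ⟨y, k, l, hkl⟩ : ∃ y k l, f y k l ≠ 0 := by
    by_contra! h
    exact hf0 (by ext y k l; exact h y k l)
  obtain ⟨c, hc⟩ := hmin (unit y l k)
  have hcv : c = f y k l := by
    have h := congrFun (congrFun (congrFun hc y) k) l
    rw [mul_unit_mul_apply] at h
    exact (mul_right_cancel₀ hkl h).symm
  have h1 : tr (f * unit y l k * f) = f y k l := by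
    rw [tr_mul_comm, ← mul_assoc, hf, tr_mul_comm, ← star_unit, tr_star_unit_mul]
  rw [hc, tr_smul, hcv] at h1
  exact mul_left_cancel₀ hkl (by rw [h1, mul_one])

theorem unit_ne_zero (x : X) (i j : ι x) : (unit x i j : MMat ι) ≠ 0 := fun h => by
  have := congrFun (congrFun (congrFun h x) i) j
  simp [unit] at this

/-- An isomorphism of multi-matrix algebras preserves the trace. -/
theorem tr_algEquiv (E : MMat ι ≃ₐ[ℂ] MMat κ) (a : MMat ι) : tr (E a) = tr a := by
  have hu : ∀ x (i j : ι x), tr (E (unit x i j)) = tr (unit x i j : MMat ι) := by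
    intro x i j
    by_cases hij : i = j
    · subst hij
      rw [tr_eq_one_of_minimal, tr_eq_one_of_minimal]
      · exact unit_mul_unit x i i i
      · exact unit_ne_zero x i i
      · exact fun b => ⟨_, unit_mul_mul_unit x i i i i b⟩
      · rw [← map_mul, unit_mul_unit]
      · simpa using unit_ne_zero x i i
      · intro b
        obtain ⟨b, rfl⟩ := E.surjective b
        exact ⟨_, by rw [← map_mul, ← map_mul, unit_mul_mul_unit, map_smul]⟩
    -- Off the diagonal `e_ij = e_ii e_ij` but `e_ij e_ii = 0`, so cyclicity kills both traces.
    · rw [← unit_mul_unit x i i j, map_mul, tr_mul_comm, ← map_mul, tr_mul_comm (unit x i i),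
        unit_mul_unit_of_ne x i i (Ne.symm hij)]
      simp [tr]
  rw [eq_sum_unit a]
  simp only [map_sum, tr_sum, map_smul, tr_smul, hu]

end Trace

/-! ### The channel state of an isomorphism as a partial swap. -/

section ChannelState

variable {X Y : Type*} {ι : X → Type*} {κ : Y → Type*}

variable [Fintype X] [DecidableEq X] [∀ x, Fintype (ι x)] [∀ x, DecidableEq (ι x)]
variable [Fintype Y] [DecidableEq Y] [∀ y, Fintype (κ y)] [∀ y, DecidableEq (κ y)]

theorem tmul_mul_tmul (a b : MMat ι) (c d : MMat κ) :
    tmul a c * tmul b d = tmul (a * b) (c * d) := by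
  funext z; exact (Matrix.mul_kronecker_mul _ _ _ _).symm

theorem tmul_one_one : (tmul 1 1 : MMat (TIdx ι κ)) = 1 := by
  funext z; exact Matrix.one_kronecker_one

theorem tmul_pow (a : MMat ι) (c : MMat κ) (n : ℕ) : tmul a c ^ n = tmul (a ^ n) (c ^ n) := by
  induction n with
  | zero => simp [tmul_one_one]
  | succ n ih => rw [pow_succ, ih, tmul_mul_tmul, ← pow_succ, ← pow_succ]

theorem tmul_one_mul_apply (a : MMat ι) (t : MMat (TIdx ι κ)) (z : X × Y) (u v : ι z.1 × κ z.2) :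
    (tmul a 1 * t : MMat (TIdx ι κ)) z u v = ∑ i, a z.1 u.1 i * t z (i, u.2) v := by
  simp [tmul, Matrix.mul_apply, Fintype.sum_prod_type, Matrix.one_apply]

theorem mul_tmul_one_apply (a : MMat ι) (t : MMat (TIdx ι κ)) (z : X × Y) (u v : ι z.1 × κ z.2) :
    (t * tmul a 1 : MMat (TIdx ι κ)) z u v = ∑ i, t z u (i, v.2) * a z.1 i v.1 := by
  simp [tmul, Matrix.mul_apply, Fintype.sum_prod_type, Matrix.one_apply]

theorem one_tmul_mul_apply (b : MMat κ) (t : MMat (TIdx ι κ)) (z : X × Y) (u v : ι z.1 × κ z.2) :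
    (tmul 1 b * t : MMat (TIdx ι κ)) z u v = ∑ k, b z.2 u.2 k * t z (u.1, k) v := by
  simp [tmul, Matrix.mul_apply, Fintype.sum_prod_type, Matrix.one_apply]

theorem mul_one_tmul_apply (b : MMat κ) (t : MMat (TIdx ι κ)) (z : X × Y) (u v : ι z.1 × κ z.2) :
    (t * tmul 1 b : MMat (TIdx ι κ)) z u v = ∑ k, t z u (v.1, k) * b z.2 k v.2 := by
  simp [tmul, Matrix.mul_apply, Fintype.sum_prod_type, Matrix.one_apply]

theorem unit_mul_eq_sum (x : X) (i j : ι x) (a : MMat ι) :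
    unit x i j * a = ∑ k, a x j k • unit x i k := by
  ext y r s
  by_cases h : y = x
  · subst h
    simp [unit, Matrix.sum_apply, Matrix.mul_apply, Matrix.single_apply, ite_and]
  · simp [unit, Pi.single_eq_of_ne h, Matrix.sum_apply]

theorem mul_unit_eq_sum (x : X) (i j : ι x) (a : MMat ι) :
    a * unit x i j = ∑ k, a x k i • unit x k j := by
  ext y r s
  by_cases h : y = x
  · subst h
    simp [unit, Matrix.sum_apply, Matrix.mul_apply, Matrix.single_apply, ite_and]
  · simp [unit, Pi.single_eq_of_ne h, Matrix.sum_apply]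

/-- The unit inside `E` carries transposed indices, so a left factor `a ⊗ 1` acts on it from the
right. Multiplicativity of `E` later lets `E a` emerge on the other side of the channel state. -/
theorem tmul_one_mul_channelState_apply (E : MMat ι →ₗ[ℂ] MMat κ) (a : MMat ι)
    (z : X × Y) (u v : ι z.1 × κ z.2) :
    (tmul a 1 * channelState E : MMat (TIdx ι κ)) z u v = E (unit z.1 v.1 u.1 * a) z.2 u.2 v.2 := by
  simp [tmul_one_mul_apply, channelState_apply, unit_mul_eq_sum, Matrix.sum_apply]

theorem channelState_mul_tmul_one_apply (E : MMat ι →ₗ[ℂ] MMat κ) (a : MMat ι)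
    (z : X × Y) (u v : ι z.1 × κ z.2) :
    (channelState E * tmul a 1 : MMat (TIdx ι κ)) z u v = E (a * unit z.1 v.1 u.1) z.2 u.2 v.2 := by
  simp [mul_tmul_one_apply, channelState_apply, mul_unit_eq_sum, Matrix.sum_apply, mul_comm]

variable (E : MMat ι ≃ₐ[ℂ] MMat κ)

theorem tmul_one_mul_channelState (a : MMat ι) :
    tmul a 1 * channelState E.toLinearMap = channelState E.toLinearMap * tmul 1 (E a) := by
  ext z u v
  rw [tmul_one_mul_channelState_apply, mul_one_tmul_apply]
  simp [channelState_apply, Matrix.mul_apply]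

theorem one_tmul_mul_channelState (a : MMat ι) :
    tmul 1 (E a) * channelState E.toLinearMap = channelState E.toLinearMap * tmul a 1 := by
  ext z u v
  rw [channelState_mul_tmul_one_apply, one_tmul_mul_apply]
  simp [channelState_apply, Matrix.mul_apply]

theorem tmul_eq_mul (a : MMat ι) (b : MMat κ) : tmul a b = tmul a 1 * tmul 1 b := by
  rw [tmul_mul_tmul, mul_one, one_mul]

theorem tmul_eq_mul' (a : MMat ι) (b : MMat κ) : tmul a b = tmul 1 b * tmul a 1 := by
  rw [tmul_mul_tmul, mul_one, one_mul]

theorem tmul_mul_channelState (a b : MMat ι) :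
    tmul a (E b) * channelState E.toLinearMap = channelState E.toLinearMap * tmul b (E a) := by
  rw [tmul_eq_mul, mul_assoc, one_tmul_mul_channelState, ← mul_assoc, tmul_one_mul_channelState,
    mul_assoc, ← tmul_eq_mul']

/-- The swap trick: the diagonal entries add up to `∑ tr (E (b e_ii a))`; `E` drops out by trace
invariance and the `e_ii` sum to `1`. -/
theorem tr_tmul_mul_channelState (a b : MMat ι) :
    tr (tmul a (E b) * channelState E.toLinearMap) = tr (a * b) := by
  have h : ∀ z (u v : ι z.1 × κ z.2), (tmul a (E b) * channelState E.toLinearMap : MMat (TIdx ι κ)) z u v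
      = E (b * (unit z.1 v.1 u.1 * a)) z.2 u.2 v.2 := by
    intro z u v
    rw [tmul_eq_mul', mul_assoc, one_tmul_mul_apply]
    simp_rw [tmul_one_mul_channelState_apply]
    simp [Matrix.mul_apply]
  have h2 : ∑ x, ∑ i, (unit x i i : MMat ι) = 1 := by
    rw [eq_sum_unit (1 : MMat ι)]
    simp [Matrix.one_apply, ite_smul]
  have h3 : tr (tmul a (E b) * channelState E.toLinearMap)
      = ∑ x, ∑ i, tr (E (b * (unit x i i * a))) := by
    simp only [tr, Matrix.trace, Matrix.diag_apply, h, Fintype.sum_prod_type]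
    refine Finset.sum_congr rfl fun x _ => ?_
    rw [Finset.sum_comm]
  rw [h3]
  simp only [tr_algEquiv, ← tr_sum, ← Finset.mul_sum, ← Finset.sum_mul, h2, one_mul]
  exact tr_mul_comm _ _

theorem channelState_mul_self_apply (z : X × Y) (u v : ι z.1 × κ z.2) :
    (channelState E.toLinearMap * channelState E.toLinearMap : MMat (TIdx ι κ)) z u v
      = if u.1 = v.1 then E (∑ i, unit z.1 i i) z.2 u.2 v.2 else 0 := by
  have h : (channelState E.toLinearMap * channelState E.toLinearMap : MMat (TIdx ι κ)) z u v
      = ∑ i, E (unit z.1 i u.1 * unit z.1 v.1 i) z.2 u.2 v.2 := by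
    simp [Matrix.mul_apply, channelState_apply, Fintype.sum_prod_type]
  rw [h]
  split_ifs with huv
  · rw [← huv]
    simp [unit_mul_unit, Matrix.sum_apply]
  · simp [unit_mul_unit_of_ne _ _ _ huv]

/-- The square is `1 ⊗ E(1_x)` on the blocks over `x`. It need not be `1`, because blocks not
matched by `E` vanish, but `1_x` is absorbed by every unit of block `x`. -/
theorem channelState_pow_three :
    channelState E.toLinearMap * channelState E.toLinearMap * channelState E.toLinearMap
      = channelState E.toLinearMap := by
  ext z u v
  have h : (∑ i, unit z.1 i i) * unit z.1 v.1 u.1 = (unit z.1 v.1 u.1 : MMat ι) := by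
    rw [Finset.sum_mul, Finset.sum_eq_single v.1]
    · exact unit_mul_unit _ _ _ _
    · exact fun i _ hi => unit_mul_unit_of_ne _ _ _ hi
    · simp
  rw [Pi.mul_apply, Matrix.mul_apply]
  simp_rw [channelState_mul_self_apply, channelState_apply]
  conv_rhs => rw [← h]
  simp [Fintype.sum_prod_type, Matrix.mul_apply]

end ChannelState

/-! ### Entropy from traces of odd powers. -/

section Entropy

theorem trace_pow_eq_sum_eigenvalues {n : Type*} [Fintype n] [DecidableEq n] {A : Matrix n n ℂ}
    (hA : A.IsHermitian) (k : ℕ) : (A ^ k).trace = ∑ i, (hA.eigenvalues i : ℂ) ^ k := by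
  conv_lhs => rw [hA.spectral_theorem, ← map_pow, Matrix.diagonal_pow]
  rw [Unitary.conjStarAlgAut_apply, Matrix.trace_mul_cycle]
  simp [Matrix.trace_diagonal]

/-- A polynomial in `t ^ 2` which agrees with `log |t|` on a finite set. -/
theorem exists_polynomial_eval_sq_eq_log_abs (s : Finset ℝ) :
    ∃ g : Polynomial ℝ, ∀ t ∈ s, g.eval (t ^ 2) = Real.log |t| := by
  -- Interpolating at the squares makes `t` and `-t` share a node consistently; `t = 0` is covered
  -- by `Real.log 0 = 0`.
  refine ⟨Lagrange.interpolate (s.image (· ^ 2)) id fun r => Real.log √r, fun t ht => ?_⟩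
  have := Lagrange.eval_interpolate_at_node (s := s.image (· ^ 2)) (v := id)
    (fun r : ℝ => Real.log √r) (Set.injOn_id _) (Finset.mem_image_of_mem _ ht)
  simpa [Real.sqrt_sq_eq_abs] using this

theorem sum_mul_log_abs_eq {S : Type*} [Fintype S] {g : Polynomial ℝ} {f : S → ℝ}
    (hf : ∀ i, g.eval (f i ^ 2) = Real.log |f i|) :
    ∑ i, f i * Real.log |f i|
      = ∑ k ∈ Finset.range (g.natDegree + 1), g.coeff k * ∑ i, f i ^ (2 * k + 1) := by
  simp_rw [Finset.mul_sum]
  rw [Finset.sum_comm]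
  refine Finset.sum_congr rfl fun i _ => ?_
  rw [← hf, Polynomial.eval_eq_sum_range, Finset.mul_sum]
  exact Finset.sum_congr rfl fun k _ => by ring

/-- The entropy of hermitian matrices is determined by the traces of the odd powers. -/
theorem matEntropy_eq_of_trace_odd_pow {m n : Type*} [Fintype m] [DecidableEq m] [Fintype n]
    [DecidableEq n] {A : Matrix m m ℂ} {B : Matrix n n ℂ} (hA : A.IsHermitian)
    (hB : B.IsHermitian) (h : ∀ k, (A ^ (2 * k + 1)).trace = (B ^ (2 * k + 1)).trace) :
    matEntropy A = matEntropy B := by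
  -- A single polynomial serves both spectra, so the two entropies are the same combination of odd
  -- power sums.
  obtain ⟨g, hg⟩ := exists_polynomial_eval_sq_eq_log_abs
    (Finset.univ.image hA.eigenvalues ∪ Finset.univ.image hB.eigenvalues)
  have hk : ∀ k, ∑ i, hA.eigenvalues i ^ (2 * k + 1) = ∑ i, hB.eigenvalues i ^ (2 * k + 1) := by
    intro k
    have := h k
    rw [trace_pow_eq_sum_eigenvalues hA, trace_pow_eq_sum_eigenvalues hB] at this
    exact_mod_cast this
  rw [matEntropy_eq hA, matEntropy_eq hB, sum_mul_log_abs_eq fun i => hg _ (by simp),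
    sum_mul_log_abs_eq fun i => hg _ (by simp)]
  simp_rw [hk]

variable {X Y : Type*} {ι : X → Type*} {κ : Y → Type*}
variable [Fintype X] [DecidableEq X] [∀ x, Fintype (ι x)] [∀ x, DecidableEq (ι x)]
variable [Fintype Y] [DecidableEq Y] [∀ y, Fintype (κ y)] [∀ y, DecidableEq (κ y)]

theorem trace_blockDiagonal'_pow (a : MMat ι) (k : ℕ) :
    (Matrix.blockDiagonal' a ^ k).trace = tr (a ^ k) := by
  rw [← Matrix.blockDiagonal'_pow, Matrix.trace_blockDiagonal', tr]

theorem isHermitian_blockDiagonal' {a : MMat ι} (ha : IsSelfAdjoint a) :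
    (Matrix.blockDiagonal' a).IsHermitian := by
  rw [Matrix.IsHermitian, Matrix.blockDiagonal'_conjTranspose]
  exact congrArg _ ha

theorem entropy_eq_of_tr_odd_pow {a : MMat ι} {b : MMat κ} (ha : IsSelfAdjoint a)
    (hb : IsSelfAdjoint b) (h : ∀ k, tr (a ^ (2 * k + 1)) = tr (b ^ (2 * k + 1))) :
    entropy a = entropy b :=
  matEntropy_eq_of_trace_odd_pow (isHermitian_blockDiagonal' ha) (isHermitian_blockDiagonal' hb)
    fun k => by rw [trace_blockDiagonal'_pow, trace_blockDiagonal'_pow, h]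

theorem IsState.isSelfAdjoint {ρ : MMat ι} (hρ : IsState ρ) : IsSelfAdjoint ρ := by
  funext x
  exact (hρ.posSemidef x).1

theorem entropy_starAlgEquiv (E : MMat ι ≃⋆ₐ[ℂ] MMat κ) {a : MMat ι} (ha : IsSelfAdjoint a) :
    entropy (E a) = entropy a := by
  refine entropy_eq_of_tr_odd_pow ?_ ha fun k => ?_
  · rw [isSelfAdjoint_iff, ← map_star, ha.star_eq]
  · rw [← map_pow]
    exact tr_algEquiv E.toAlgEquiv _

end Entropy

/-! ### Odd power traces of the symmetric bloom. -/

section Bloom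

variable {X Y : Type*} {ι : X → Type*} {κ : Y → Type*}
variable [Fintype X] [DecidableEq X] [∀ x, Fintype (ι x)] [∀ x, DecidableEq (ι x)]
variable [Fintype Y] [DecidableEq Y] [∀ y, Fintype (κ y)] [∀ y, DecidableEq (κ y)]

open scoped ComplexOrder MatrixOrder in
theorem matPow_mul_matPow {ρ : MMat ι} (hρ : IsState ρ) {p : ℝ} (hp : p ∈ Set.Icc (0 : ℝ) 1) :
    matPow ρ p * matPow ρ (1 - p) = ρ := by
  funext x
  have h : IsSelfAdjoint (ρ x) := (hρ.posSemidef x).1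
  have hnn : 0 ≤ ρ x := (hρ.posSemidef x).nonneg
  have h1p : 0 ≤ 1 - p := sub_nonneg.2 hp.2
  rw [Pi.mul_apply, matPow, matPow,
    ← cfc_mul _ _ _ (Real.continuous_rpow_const hp.1).continuousOn
      (Real.continuous_rpow_const h1p).continuousOn]
  conv_rhs => rw [← cfc_id' ℝ (ρ x)]
  refine cfc_congr fun t ht => ?_
  have ht0 : 0 ≤ t := spectrum_nonneg_of_nonneg hnn ht
  -- Nonnegativity of both exponents is what covers a zero eigenvalue, including `p = 0` and `p =
  -- 1`.
  rw [← Real.rpow_add_of_nonneg ht0 hp.1 h1p, add_sub_cancel, Real.rpow_one]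

theorem commute_matPow (ρ : MMat ι) (p q : ℝ) : Commute (matPow ρ p) (matPow ρ q) := by
  funext x
  exact cfc_commute_cfc _ _ _

variable (E : MMat ι ≃ₐ[ℂ] MMat κ)

theorem bloom_eq (p : ℝ) (ρ : MMat ι) :
    bloom p ρ E.toLinearMap
      = tmul (matPow ρ p) (E (matPow ρ (1 - p))) * channelState E.toLinearMap := by
  rw [bloom, mul_assoc, ← one_tmul_mul_channelState, ← mul_assoc, ← tmul_eq_mul]

theorem mul_pow_odd_of_pow_three {R : Type*} [Monoid R] {c j : R} (h : Commute c j)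
    (hj : j * j * j = j) (k : ℕ) : (c * j) ^ (2 * k + 1) = c ^ (2 * k + 1) * j := by
  rw [h.mul_pow]
  congr 1
  induction k with
  | zero => simp
  | succ k ih => rw [show 2 * (k + 1) + 1 = 2 * k + 1 + 1 + 1 by ring, pow_succ, pow_succ, ih, hj]

/-- For commuting `a` and `b`, the functional `tr (· 𝒥[ℰ])` takes the powers of
`a ⊗ ℰ b + b ⊗ ℰ a` to the traces of the powers of `2 a b`. -/
theorem tr_symm_tmul_pow_mul_channelState {a b : MMat ι} (hab : Commute a b) (n : ℕ) :
    tr ((tmul a (E b) + tmul b (E a)) ^ n * channelState E.toLinearMap)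
      = 2 ^ n * tr ((a * b) ^ n) := by
  have hc : Commute (tmul a (E b)) (tmul b (E a)) := by
    rw [Commute, SemiconjBy, tmul_mul_tmul, tmul_mul_tmul, ← map_mul, ← map_mul, hab.eq]
  rw [hc.add_pow, Finset.sum_mul, tr_sum]
  have h : ∀ m ∈ Finset.range (n + 1),
      tr (tmul a (E b) ^ m * tmul b (E a) ^ (n - m) * (n.choose m : MMat (TIdx ι κ))
        * channelState E.toLinearMap) = n.choose m * tr ((a * b) ^ n) := by
    intro m hm
    have hmn : m + (n - m) = n := Nat.add_sub_cancel' (Finset.mem_range_succ_iff.1 hm)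
    rw [mul_assoc, (Nat.cast_commute _ _).eq, ← mul_assoc, ← nsmul_eq_mul', ← Nat.cast_smul_eq_nsmul ℂ,
      tr_smul, tmul_pow, tmul_pow, tmul_mul_tmul, ← map_pow, ← map_pow, ← map_mul,
      tr_tmul_mul_channelState]
    congr 2
    -- Whatever `m` is, `a^m b^(n-m) b^m a^(n-m) = (a b)^n`, so only the binomial coefficients
    -- remain to be summed.
    rw [← mul_assoc, mul_assoc (a ^ m), ← pow_add, add_comm (n - m), hmn, mul_assoc,
      (hab.symm.pow_pow n (n - m)).eq, ← mul_assoc, ← pow_add, hmn, hab.mul_pow]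
  rw [Finset.sum_congr rfl h, ← Finset.sum_mul]
  congr 1
  exact_mod_cast Nat.sum_range_choose n

theorem tr_symBloom_odd_pow {ρ : MMat ι} (hρ : IsState ρ) {p : ℝ} (hp : p ∈ Set.Icc (0 : ℝ) 1)
    (k : ℕ) : tr (symBloom p ρ E.toLinearMap ^ (2 * k + 1)) = tr (ρ ^ (2 * k + 1)) := by
  have hc : Commute (tmul (matPow ρ p) (E (matPow ρ (1 - p)))
      + tmul (matPow ρ (1 - p)) (E (matPow ρ p))) (channelState E.toLinearMap) := by
    -- Passing through the channel state exchanges the two summands; this is where symmetrizing the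
    -- bloom is needed.
    rw [Commute, SemiconjBy, add_mul, mul_add, tmul_mul_channelState, tmul_mul_channelState,
      add_comm]
  rw [symBloom, bloom_eq, bloom_eq, sub_sub_cancel, ← add_mul, smul_pow,
    mul_pow_odd_of_pow_three hc (channelState_pow_three E), tr_smul,
    tr_symm_tmul_pow_mul_channelState E (commute_matPow ρ p (1 - p)), matPow_mul_matPow hρ hp,
    ← mul_assoc, ← mul_pow]
  norm_num

theorem entropy_symBloom (E : MMat ι ≃⋆ₐ[ℂ] MMat κ) {ρ : MMat ι} (hρ : IsState ρ) {p : ℝ}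
    (hp : p ∈ Set.Icc (0 : ℝ) 1) :
    entropy (symBloom p ρ E.toAlgEquiv.toLinearMap) = entropy ρ :=
  entropy_eq_of_tr_odd_pow (isSelfAdjoint_symBloom p fun a => map_star E a) hρ.isSelfAdjoint
    (tr_symBloom_odd_pow E.toAlgEquiv hρ hp)

end Bloom

end QuantumProcess

theorem theorem10p1 {X Y : Type*} {ι : X → Type*} {κ : Y → Type*}
    [Fintype X] [DecidableEq X] [∀ x, Fintype (ι x)] [∀ x, DecidableEq (ι x)]
    [Fintype Y] [DecidableEq Y] [∀ y, Fintype (κ y)] [∀ y, DecidableEq (κ y)]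
    (E : QuantumProcess.MMat ι ≃⋆ₐ[ℂ] QuantumProcess.MMat κ)
    (ρ : QuantumProcess.MMat ι) (hρ : QuantumProcess.IsState ρ)
    (p : ℝ) (hp : p ∈ Set.Icc (0 : ℝ) 1) :
    (QuantumProcess.psiEntropy (QuantumProcess.symBloom p) ρ E.toAlgEquiv.toLinearMap
        = QuantumProcess.psiMutualInfo (QuantumProcess.symBloom p) ρ E.toAlgEquiv.toLinearMap ∧
      QuantumProcess.psiMutualInfo (QuantumProcess.symBloom p) ρ E.toAlgEquiv.toLinearMap
        = QuantumProcess.entropy ρ) ∧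
    (QuantumProcess.psiCondEntropy (QuantumProcess.symBloom p) ρ E.toAlgEquiv.toLinearMap
        = QuantumProcess.psiInfoDisc (QuantumProcess.symBloom p) ρ E.toAlgEquiv.toLinearMap ∧
      QuantumProcess.psiInfoDisc (QuantumProcess.symBloom p) ρ E.toAlgEquiv.toLinearMap = 0) := by
  have h1 := QuantumProcess.entropy_symBloom E hρ hp
  have h2 : QuantumProcess.entropy (E ρ) = QuantumProcess.entropy ρ :=
    QuantumProcess.entropy_starAlgEquiv E hρ.isSelfAdjoint
  simp [QuantumProcess.psiCondEntropy, QuantumProcess.psiInfoDisc, QuantumProcess.psiMutualInfo,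
    QuantumProcess.psiEntropy, h1, h2]
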